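/- Let $F(z)=-|z|^2z+|z|^4z$ and let $u$ be a forward-global solution of the cubic-quintic NLS $(i\partial_t+\Delta)u=F(u)$ on $[0,\infty)\times\mathbb{R}^2$; that is, $u\in C([0,\infty);H^1(\mathbb{R}^2))$ and \[ u(t)=e^{it\Delta}u(0)-i\int_0^t e^{i(t-s)\Delta}F(u(s))\,ds\qquad\text{for all }t\ge 0, \] where $F(u(\cdot))\in L^1_{\mathrm{loc}}([0,\infty);L^2(\mathbb{R}^2))$. Suppose that $u$ is a compact solution: $\sup_{t\ge0}\|u(t)\|_{H^1}<\infty$ and there is a function $\lambda:[0,\infty)\to[1,\infty)$ such that the set $\{\lambda(t)\,u(t,\lambda(t)\,\cdot\,):t\in[0,\infty)\}$ is pre-compact in $L^2(\mathbb{R}^2)$. (Neither radial symmetry nor any condition on the mass or on the $L^4_{t,x}$ norm of $u$ is required.) Then for every $t\ge0$ the function $s\mapsto e^{i(t-s)\Delta}F(u(s))$ is integrable on $[t,T]$ with values in $L^2(\mathbb{R}^2)$ for every $T\ge t$, and \[ u(t)=\lim_{T\to\infty} i\int_t^T e^{i(t-s)\Delta}F(u(s))\,ds \] as a weak limit in $L^2(\mathbb{R}^2)$.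 -/

import Mathlib

open MeasureTheory Filter Topology FourierTransform
open scoped ENNReal

namespace CubicQuinticNLS

/-- The plane `ℝ²` with its Euclidean norm and Lebesgue measure. -/
abbrev Plane : Type := EuclideanSpace ℝ (Fin 2)

/-- The complex Hilbert space `L²(ℝ²)`. -/
abbrev L2 : Type := Lp ℂ 2 (volume : Measure Plane)

/-- The Fourier symbol of the free propagator `e^{itΔ}`. The Fourier transform is normalized with
kernel `e^{-2πi x·ξ}`, so that `Δ` has the symbol `-4π²|ξ|²`. -/
noncomputable def symbol (t : ℝ) (ξ : Plane) : ℂ :=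
  Complex.exp (-Complex.I * ((t * (4 * Real.pi ^ 2 * ‖ξ‖ ^ 2) : ℝ) : ℂ))

theorem memLp_symbol_mul (t : ℝ) (f : L2) :
    MemLp (fun ξ : Plane => symbol t ξ * f ξ) 2 volume := by
  refine (Lp.memLp f).of_le ?_ ?_
  · refine AEStronglyMeasurable.mul ?_ (Lp.aestronglyMeasurable f)
    apply Continuous.aestronglyMeasurable
    unfold symbol
    fun_prop
  · refine ae_of_all _ fun ξ => ?_
    have h : ‖symbol t ξ‖ = 1 := by
      unfold symbol
      rw [Complex.norm_exp, neg_mul, Complex.neg_re, Complex.I_mul_re, Complex.ofReal_im]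
      simp
    rw [norm_mul, h, one_mul]

/-- The free Schrödinger propagator `e^{itΔ}` on `L²(ℝ²)`. -/
noncomputable def propagator (t : ℝ) (f : L2) : L2 :=
  𝓕⁻ ((memLp_symbol_mul t (𝓕 f)).toLp _)

/-- The `H¹(ℝ²)` norm `(‖f‖² + ‖∇f‖²)^{1/2}` of `f ∈ L²(ℝ²)`, computed on the Fourier side;
it is `∞` when `f` is not in `H¹`. -/
noncomputable def h1Norm (f : L2) : ℝ≥0∞ :=
  (∫⁻ ξ : Plane, ENNReal.ofReal (1 + 4 * Real.pi ^ 2 * ‖ξ‖ ^ 2) * ‖(𝓕 f : L2) ξ‖ₑ ^ 2)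
    ^ (1 / 2 : ℝ)

/-- The nonlinearity `F(z) = -|z|² z + |z|⁴ z`. -/
noncomputable def F (z : ℂ) : ℂ :=
  -((‖z‖ ^ 2 : ℝ) : ℂ) * z + ((‖z‖ ^ 4 : ℝ) : ℂ) * z

open Classical in
/-- `F(f)` as an element of `L²(ℝ²)`. The value `0` outside the natural domain is never used:
every `f ∈ H¹(ℝ²)` satisfies `F(f) ∈ L²(ℝ²)`. -/
noncomputable def nonlinearity (f : L2) : L2 :=
  if h : MemLp (fun x : Plane => F (f x)) 2 volume then h.toLp _ else 0

/-- Forward-global (strong, `H¹`) solutions of `(i∂ₜ + Δ)u = -|u|²u + |u|⁴u` on `[0,∞) × ℝ²`: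
`u ∈ C([0,∞); H¹)` and the Duhamel formula holds, with an integral that converges absolutely
in `L²`. The values of `u` at negative times play no role. -/
structure IsForwardGlobalSolution (u : ℝ → L2) : Prop where
  h1Norm_lt_top : ∀ t : ℝ, 0 ≤ t → h1Norm (u t) < ∞
  continuous : ∀ t₀ : ℝ, 0 ≤ t₀ →
    Tendsto (fun t => h1Norm (u t - u t₀)) (𝓝[Set.Ici 0] t₀) (𝓝 0)
  memLp_nonlinearity : ∀ t : ℝ, 0 ≤ t → MemLp (fun x : Plane => F (u t x)) 2 volume
  integrable_nonlinearity : ∀ T : ℝ, 0 ≤ T →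
    IntervalIntegrable (fun s => nonlinearity (u s)) volume 0 T
  duhamel : ∀ t : ℝ, 0 ≤ t →
    u t = propagator t (u 0) -
      Complex.I • ∫ s in (0 : ℝ)..t, propagator (t - s) (nonlinearity (u s))

theorem memLp_rescale (l : ℝ) (hl : l ≠ 0) (f : L2) :
    MemLp (fun x : Plane => (l : ℂ) * f (l • x)) 2 volume := by
  have hf : MemLp f 2 (Measure.map (fun x : Plane => l • x) volume) := by
    rw [Measure.map_addHaar_smul volume hl]
    exact (Lp.memLp f).smul_measure ENNReal.ofReal_ne_top
  have h := (memLp_map_measure_iff hf.1 (measurable_const_smul l).aemeasurable).1 hf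
  exact h.const_mul (l : ℂ)

/-- The mass-preserving dilation `x ↦ l f(l x)` of `f ∈ L²(ℝ²)` (used only for `l ≥ 1`). -/
noncomputable def rescale (l : ℝ) (f : L2) : L2 :=
  if hl : l ≠ 0 then (memLp_rescale l hl f).toLp _ else 0

/-- `u` is a compact solution with scale function `lam : [0,∞) → [1,∞)`: a forward-global solution,
bounded in `H¹`, whose orbit is pre-compact in `L²` modulo rescaling by `lam`. -/
structure IsCompactSolution (u : ℝ → L2) (lam : ℝ → ℝ) : Prop where
  solution : IsForwardGlobalSolution u
  bounded : ∃ A : ℝ, ∀ t : ℝ, 0 ≤ t → h1Norm (u t) ≤ ENNReal.ofReal A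
  one_le_scale : ∀ t : ℝ, 0 ≤ t → 1 ≤ lam t
  precompact : IsCompact (closure ((fun t => rescale (lam t) (u t)) '' Set.Ici (0 : ℝ)))

end CubicQuinticNLS

namespace CubicQuinticNLS

open scoped SchwartzMap

/-! ### The Fourier transform on `L¹ ∩ L²` -/

/-! Duhamel's formula makes the truncated integral equal to `u t - propagator (t - T) (u T)`
(`smul_integral_eq`), so the claim is that the last term is weakly null. Paired with `g`, it becomes
the inner product of `propagator (T - t) g` with `u T`. Rescaling both vectors by `lam T` preserves
it (`inner_rescale_rescale`) and puts the second one in a fixed compact set, where weak convergence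
of the first suffices (`tendsto_inner_zero_of_isCompact`).

It remains to see that a free evolution goes weakly to zero whatever scale it is viewed at, since
nothing is known about how `lam` grows or oscillates. By density and equiboundedness this is checked
on modulated Gaussians, whose matrix coefficients are explicit and decay in time uniformly in the
scale (`norm_inner_rescale_propagator_gaussianL2_le`). -/

theorem coeFn_fourier_toLp {f : Plane → ℂ} (hf : MemLp f 2 volume) (hf₁ : Integrable f volume) :
    ((𝓕 (hf.toLp f) : L2) : Plane → ℂ) =ᵐ[volume] 𝓕 f := by
  have hcont : Continuous (𝓕 f) := VectorFourier.fourierIntegral_continuous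
    Real.continuous_fourierChar (by exact continuous_inner) hf₁
  -- Both sides are locally integrable, so testing against smooth compactly supported functions is
  -- enough. There the `L²` transform moves onto the test function through tempered distributions,
  -- and the `L¹` transform by Fubini.
  refine ae_eq_of_integral_contDiff_smul_eq
    ((Lp.memLp (𝓕 (hf.toLp f) : L2)).locallyIntegrable (by norm_num))
    hcont.locallyIntegrable fun g hg hgc => ?_
  have hg₁ : HasCompactSupport (Complex.ofRealCLM ∘ g) := hgc.comp_left rfl
  have hg₂ : ContDiff ℝ (⊤ : ℕ∞) (Complex.ofRealCLM ∘ g) := by fun_prop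
  set φ : 𝓢(Plane, ℂ) := hg₁.toSchwartzMap hg₂ with hφ
  have key := congrArg (fun T => T φ) (Lp.fourier_toTemperedDistribution_eq (hf.toLp f))
  simp only [TemperedDistribution.fourier_apply, Lp.toTemperedDistribution_apply] at key
  have h₁ : ∫ x, (𝓕 φ) x • (hf.toLp f) x = ∫ x, (𝓕 φ) x • f x :=
    integral_congr_ae (hf.coeFn_toLp.mono fun x hx => by simp only [hx])
  have h₂ : ∫ x, (𝓕 φ) x • f x = ∫ x, φ x • 𝓕 f x :=
    VectorFourier.integral_fourierIntegral_smul_eq_flip (L := innerₗ Plane)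
      Real.continuous_fourierChar (by exact continuous_inner) φ.integrable hf₁ |>.trans (by
        simp only [flip_innerₗ]; rfl)
  rw [h₁, h₂] at key
  simpa [hφ] using key.symm

/-! ### The free propagator -/

theorem norm_symbol (t : ℝ) (ξ : Plane) : ‖symbol t ξ‖ = 1 := by
  unfold symbol
  rw [Complex.norm_exp, neg_mul, Complex.neg_re, Complex.I_mul_re, Complex.ofReal_im]
  simp

theorem symbol_add (s t : ℝ) (ξ : Plane) : symbol (s + t) ξ = symbol s ξ * symbol t ξ := by
  unfold symbol
  rw [← Complex.exp_add]
  congr 1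
  push_cast
  ring

theorem continuous_symbol (ξ : Plane) : Continuous fun t => symbol t ξ := by
  unfold symbol
  fun_prop

theorem fourier_propagator (t : ℝ) (f : L2) :
    𝓕 (propagator t f) = (memLp_symbol_mul t (𝓕 f)).toLp _ :=
  fourier_fourierInv_eq _

theorem coeFn_fourier_propagator (t : ℝ) (f : L2) :
    ((𝓕 (propagator t f) : L2) : Plane → ℂ) =ᵐ[volume] fun ξ => symbol t ξ * (𝓕 f : L2) ξ := by
  rw [fourier_propagator]
  exact MemLp.coeFn_toLp _

theorem fourier_injective : Function.Injective (𝓕 : L2 → L2) :=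
  (Lp.fourierTransformₗᵢ Plane ℂ).injective

theorem fourier_ext {f g : L2} (h : ((𝓕 f : L2) : Plane → ℂ) =ᵐ[volume] (𝓕 g : L2)) : f = g :=
  fourier_injective (Lp.ext h)

/-- The free propagator as a linear isometry of `L²(ℝ²)`. -/
noncomputable def propagatorₗᵢ (t : ℝ) : L2 →ₗᵢ[ℂ] L2 where
  toFun := propagator t
  map_add' f g := by
    refine fourier_ext ?_
    rw [FourierTransform.fourier_add]
    filter_upwards [coeFn_fourier_propagator t (f + g), coeFn_fourier_propagator t f,
      coeFn_fourier_propagator t g, Lp.coeFn_add (𝓕 (propagator t f)) (𝓕 (propagator t g)),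
      Lp.coeFn_add (𝓕 f : L2) (𝓕 g : L2)] with ξ h₁ h₂ h₃ h₄ h₅
    rw [h₁, h₄, Pi.add_apply, h₂, h₃, FourierTransform.fourier_add, h₅, Pi.add_apply, mul_add]
  map_smul' c f := by
    refine fourier_ext ?_
    rw [RingHom.id_apply, FourierTransform.fourier_smul]
    filter_upwards [coeFn_fourier_propagator t (c • f), coeFn_fourier_propagator t f,
      Lp.coeFn_smul c (𝓕 (propagator t f)), Lp.coeFn_smul c (𝓕 f : L2)] with ξ h₁ h₂ h₃ h₄
    rw [h₁, h₃, Pi.smul_apply, h₂, FourierTransform.fourier_smul, h₄, Pi.smul_apply,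
      smul_eq_mul, smul_eq_mul, mul_left_comm]
  norm_map' f := by
    change ‖propagator t f‖ = ‖f‖
    rw [← Lp.norm_fourier_eq (propagator t f), ← Lp.norm_fourier_eq f]
    refine le_antisymm (Lp.norm_le_norm_of_ae_le ?_) (Lp.norm_le_norm_of_ae_le ?_) <;>
    · filter_upwards [coeFn_fourier_propagator t f] with ξ h
      rw [h, norm_mul, norm_symbol, one_mul]

@[simp]
theorem propagatorₗᵢ_apply (t : ℝ) (f : L2) : propagatorₗᵢ t f = propagator t f := rfl

theorem norm_propagator (t : ℝ) (f : L2) : ‖propagator t f‖ = ‖f‖ :=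
  (propagatorₗᵢ t).norm_map f

theorem propagator_add (s t : ℝ) (f : L2) :
    propagator (s + t) f = propagator s (propagator t f) := by
  refine fourier_ext ?_
  filter_upwards [coeFn_fourier_propagator (s + t) f, coeFn_fourier_propagator t f,
    coeFn_fourier_propagator s (propagator t f)] with ξ h₁ h₂ h₃
  rw [h₁, h₃, h₂, symbol_add, mul_assoc]

theorem propagator_zero (f : L2) : propagator 0 f = f := by
  refine fourier_ext ?_
  filter_upwards [coeFn_fourier_propagator 0 f] with ξ h
  rw [h]
  simp [symbol]

/-- By Plancherel this is dominated convergence on the Fourier side, with majorant `4 * ‖𝓕 f‖ ^ 2`.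
-/
theorem continuous_propagator_left (f : L2) : Continuous fun t => propagator t f := by
  have key : ∀ s t, ‖propagator s f - propagator t f‖ ^ 2 =
      ∫ ξ, ‖symbol s ξ - symbol t ξ‖ ^ 2 * ‖(𝓕 f : L2) ξ‖ ^ 2 := by
    intro s t
    rw [← Lp.norm_fourier_eq, ← inner_self_eq_norm_sq (𝕜 := ℂ), L2.inner_def,
      ← integral_re (L2.integrable_inner _ _)]
    refine integral_congr_ae ?_
    have hsub : 𝓕 (propagator s f - propagator t f) = 𝓕 (propagator s f) - 𝓕 (propagator t f) :=
      map_sub (Lp.fourierTransformₗᵢ Plane ℂ) _ _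
    rw [hsub]
    filter_upwards [coeFn_fourier_propagator s f, coeFn_fourier_propagator t f,
      Lp.coeFn_sub (𝓕 (propagator s f)) (𝓕 (propagator t f))] with ξ h₁ h₂ h₃
    rw [inner_self_eq_norm_sq, h₃, Pi.sub_apply, h₁, h₂, ← sub_mul, norm_mul, mul_pow]
  have hint : Integrable (fun ξ => ‖(𝓕 f : L2) ξ‖ ^ 2) volume :=
    (Lp.memLp (𝓕 f : L2)).integrable_norm_pow (by norm_num)
  refine continuous_iff_continuousAt.2 fun t => ?_
  rw [ContinuousAt, tendsto_iff_norm_sub_tendsto_zero]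
  have h2 : Tendsto (fun s => ‖propagator s f - propagator t f‖ ^ 2) (𝓝 t) (𝓝 0) := by
    simp only [key]
    have hc : Continuous fun s => ∫ ξ, ‖symbol s ξ - symbol t ξ‖ ^ 2 * ‖(𝓕 f : L2) ξ‖ ^ 2 := by
      refine continuous_of_dominated (bound := fun ξ => 4 * ‖(𝓕 f : L2) ξ‖ ^ 2) (fun s => ?_)
        (fun s => ae_of_all _ fun ξ => ?_) (hint.const_mul 4) (ae_of_all _ fun ξ => ?_)
      · refine AEStronglyMeasurable.mul ?_ hint.aestronglyMeasurable
        refine Continuous.aestronglyMeasurable ?_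
        unfold symbol
        fun_prop
      · rw [Real.norm_of_nonneg (by positivity)]
        gcongr
        have := norm_sub_le (symbol s ξ) (symbol t ξ)
        rw [norm_symbol, norm_symbol] at this
        nlinarith [norm_nonneg (symbol s ξ - symbol t ξ)]
      · exact (((continuous_symbol ξ).sub continuous_const).norm.pow 2).mul continuous_const
    simpa using hc.tendsto t
  simpa using h2.sqrt

/-- Joint continuity supplies the strong measurability of the Duhamel integrand. -/
theorem continuous_propagator : Continuous fun p : ℝ × L2 => propagator p.1 p.2 :=
  continuous_prod_of_continuous_lipschitzWith' _ 1 (fun t => (propagatorₗᵢ t).lipschitz)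
    continuous_propagator_left

/-! ### Rescaling -/

theorem coeFn_rescale {l : ℝ} (hl : l ≠ 0) (f : L2) :
    (rescale l f : Plane → ℂ) =ᵐ[volume] fun x => (l : ℂ) * f (l • x) := by
  rw [rescale, dif_pos hl]
  exact MemLp.coeFn_toLp _

theorem ae_comp_smul {l : ℝ} (hl : l ≠ 0) {p : Plane → Prop} (h : ∀ᵐ x, p x) :
    ∀ᵐ x, p (l • x) := by
  have hq : Measure.QuasiMeasurePreserving (fun x : Plane => l • x) volume volume := by
    refine ⟨measurable_const_smul l, ?_⟩
    rw [Measure.map_addHaar_smul volume hl]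
    exact Measure.smul_absolutelyContinuous
  exact hq.ae h

theorem inner_rescale_rescale {l : ℝ} (hl : l ≠ 0) (f g : L2) :
    inner ℂ (rescale l f) (rescale l g) = inner ℂ f g := by
  rw [L2.inner_def, L2.inner_def]
  have h : ∫ x, inner ℂ (rescale l f x) (rescale l g x) =
      ∫ x, ((l : ℂ) ^ 2) * (fun y : Plane => inner ℂ (f y) (g y)) (l • x) := by
    refine integral_congr_ae ?_
    filter_upwards [coeFn_rescale hl f, coeFn_rescale hl g] with x h₁ h₂
    rw [h₁, h₂]
    simp only [RCLike.inner_apply, map_mul, Complex.conj_ofReal]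
    ring
  rw [h, integral_const_mul,
    Measure.integral_comp_smul volume (fun y : Plane => inner ℂ (f y) (g y)) l]
  have hl' : (l : ℂ) ≠ 0 := by exact_mod_cast hl
  simp only [finrank_euclideanSpace, Fintype.card_fin]
  rw [abs_of_nonneg (by positivity), Complex.real_smul]
  push_cast
  field_simp

/-- The mass-preserving dilation by `l ≠ 0` as a linear isometry of `L²(ℝ²)`. -/
noncomputable def rescaleₗᵢ (l : ℝ) (hl : l ≠ 0) : L2 →ₗᵢ[ℂ] L2 :=
  LinearMap.isometryOfInner
    { toFun := rescale l
      map_add' := fun f g => by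
        refine Lp.ext ?_
        filter_upwards [coeFn_rescale hl (f + g), coeFn_rescale hl f, coeFn_rescale hl g,
          Lp.coeFn_add (rescale l f) (rescale l g),
          ae_comp_smul hl (Lp.coeFn_add f g)] with x h₁ h₂ h₃ h₄ h₅
        rw [h₁, h₄, Pi.add_apply, h₂, h₃, h₅, Pi.add_apply, mul_add]
      map_smul' := fun c f => by
        refine Lp.ext ?_
        filter_upwards [coeFn_rescale hl (c • f), coeFn_rescale hl f,
          Lp.coeFn_smul c (rescale l f), ae_comp_smul hl (Lp.coeFn_smul c f)] with x h₁ h₂ h₃ h₄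
        rw [h₁, RingHom.id_apply, h₃, Pi.smul_apply, h₂, h₄, Pi.smul_apply, smul_eq_mul,
          smul_eq_mul, mul_left_comm] }
    (inner_rescale_rescale hl)

/-! ### Modulated Gaussians -/

/-- The modulated Gaussian `x ↦ exp (-b|x|² + 2πi w·x)`. -/
noncomputable def gaussian (b : ℝ) (w x : Plane) : ℂ :=
  Complex.exp (-(b : ℂ) * ‖x‖ ^ 2 + 2 * Real.pi * Complex.I * (inner ℝ w x : ℝ))

theorem continuous_gaussian (b : ℝ) (w : Plane) : Continuous (gaussian b w) := by
  unfold gaussian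
  fun_prop

theorem norm_gaussian (b : ℝ) (w x : Plane) : ‖gaussian b w x‖ = Real.exp (-b * ‖x‖ ^ 2) := by
  have h : (-(b : ℂ) * ‖x‖ ^ 2 + 2 * Real.pi * Complex.I * (inner ℝ w x : ℝ)) =
      ((-b * ‖x‖ ^ 2 : ℝ) : ℂ) + ((2 * Real.pi * inner ℝ w x : ℝ) : ℂ) * Complex.I := by
    push_cast
    ring
  rw [gaussian, Complex.norm_exp, h, Complex.add_re, Complex.ofReal_re, Complex.re_ofReal_mul,
    Complex.I_re, mul_zero, add_zero]

theorem integrable_gaussian {b : ℝ} (hb : 0 < b) (w : Plane) : Integrable (gaussian b w) volume :=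
  GaussianFourier.integrable_cexp_neg_mul_sq_norm_add (by simpa using hb) _ w

theorem memLp_gaussian {b : ℝ} (hb : 0 < b) (w : Plane) : MemLp (gaussian b w) 2 volume := by
  rw [← integrable_norm_rpow_iff (continuous_gaussian b w).aestronglyMeasurable
    (by norm_num) (by norm_num)]
  refine (integrable_gaussian (b := 2 * b) (by positivity) w).norm.congr (ae_of_all _ fun x => ?_)
  simp only [norm_gaussian, ENNReal.toReal_ofNat, Real.rpow_ofNat, ← Real.exp_nat_mul]
  congr 1
  push_cast
  ring

/-- The modulated Gaussian as an element of `L²(ℝ²)`. -/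
noncomputable def gaussianL2 {b : ℝ} (hb : 0 < b) (w : Plane) : L2 :=
  (memLp_gaussian hb w).toLp _

theorem coeFn_gaussianL2 {b : ℝ} (hb : 0 < b) (w : Plane) :
    (gaussianL2 hb w : Plane → ℂ) =ᵐ[volume] gaussian b w :=
  MemLp.coeFn_toLp _

theorem coeFn_fourier_gaussianL2 {b : ℝ} (hb : 0 < b) (w : Plane) :
    ((𝓕 (gaussianL2 hb w) : L2) : Plane → ℂ) =ᵐ[volume] fun ξ =>
      (Real.pi / b : ℂ) * Complex.exp (-(Real.pi : ℂ) ^ 2 * ‖w - ξ‖ ^ 2 / b) := by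
  refine (coeFn_fourier_toLp (memLp_gaussian hb w) (integrable_gaussian hb w)).trans
    (ae_of_all _ fun ξ => ?_)
  have h := fourier_gaussian_innerProductSpace' (V := Plane) (b := (b : ℂ)) (by simpa using hb) w ξ
  rw [finrank_euclideanSpace, Fintype.card_fin, Nat.cast_ofNat, div_self two_ne_zero,
    Complex.cpow_one] at h
  exact h

/-- If `f` is orthogonal to every modulation of a fixed Gaussian, the Fourier transform of that
Gaussian times `f` vanishes identically. The product is then zero a.e., and the Gaussian has no
zeros. -/
theorem span_gaussianL2_topologicalClosure :
    (Submodule.span ℂ (Set.range (gaussianL2 Real.pi_pos))).topologicalClosure = ⊤ := by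
  rw [Submodule.topologicalClosure_eq_top_iff, Submodule.eq_bot_iff]
  intro f hf
  rw [Submodule.mem_orthogonal] at hf
  have hG := memLp_gaussian Real.pi_pos 0
  have h₁ : Integrable (fun x => gaussian Real.pi 0 x * f x) volume :=
    hG.integrable_mul (Lp.memLp f)
  have h₂ : MemLp (fun x => gaussian Real.pi 0 x * f x) 2 volume := by
    refine (Lp.memLp f).of_le h₁.aestronglyMeasurable (ae_of_all _ fun x => ?_)
    rw [norm_mul, norm_gaussian]
    refine mul_le_of_le_one_left (norm_nonneg _) (Real.exp_le_one_iff.2 ?_)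
    have := Real.pi_pos
    nlinarith [sq_nonneg ‖x‖]
  have h₃ : 𝓕 (fun x => gaussian Real.pi 0 x * f x) = 0 := by
    ext w
    have h := hf _ (Submodule.subset_span ⟨w, rfl⟩)
    rw [L2.inner_def] at h
    rw [Real.fourier_eq', Pi.zero_apply, ← h]
    refine integral_congr_ae ?_
    filter_upwards [coeFn_gaussianL2 Real.pi_pos w] with x hx
    rw [hx, RCLike.inner_apply, smul_eq_mul, gaussian, gaussian, ← Complex.exp_conj,
      ← mul_assoc, ← Complex.exp_add, mul_comm]
    congr 2
    simp [real_inner_comm, Complex.conj_ofNat]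
    ring
  have h₄ : h₂.toLp _ = 0 := by
    refine fourier_ext ?_
    have h0 : (𝓕 (0 : L2) : L2) = 0 := map_zero (Lp.fourierTransformₗᵢ Plane ℂ)
    rw [h0]
    refine (coeFn_fourier_toLp h₂ h₁).trans ?_
    rw [h₃]
    exact (Lp.coeFn_zero _ _ _).symm
  rw [Lp.eq_zero_iff_ae_eq_zero]
  filter_upwards [h₂.coeFn_toLp, (Lp.eq_zero_iff_ae_eq_zero).1 h₄] with x hx₁ hx₂
  rw [hx₁] at hx₂
  exact (mul_eq_zero.1 hx₂).resolve_left (Complex.exp_ne_zero _)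

/-- With the test Gaussian written as a dilate, the dilation cancels from the matrix coefficient by
isometry. -/
theorem rescale_gaussianL2 {l : ℝ} (hl : 0 < l) (z : Plane) :
    rescale l ((l⁻¹ : ℂ) • gaussianL2 (div_pos Real.pi_pos (pow_pos hl 2)) (l⁻¹ • z)) =
      gaussianL2 Real.pi_pos z := by
  refine Lp.ext ?_
  filter_upwards [coeFn_rescale hl.ne'
      ((l⁻¹ : ℂ) • gaussianL2 (div_pos Real.pi_pos (pow_pos hl 2)) (l⁻¹ • z)),
    ae_comp_smul hl.ne' (Lp.coeFn_smul (l⁻¹ : ℂ)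
      (gaussianL2 (div_pos Real.pi_pos (pow_pos hl 2)) (l⁻¹ • z))),
    ae_comp_smul hl.ne' (coeFn_gaussianL2 (div_pos Real.pi_pos (pow_pos hl 2)) (l⁻¹ • z)),
    coeFn_gaussianL2 Real.pi_pos z] with x h₁ h₂ h₃ h₄
  have hl' : (l : ℂ) ≠ 0 := by exact_mod_cast hl.ne'
  rw [h₁, h₂, Pi.smul_apply, h₃, h₄, smul_eq_mul, mul_inv_cancel_left₀ hl']
  unfold gaussian
  rw [real_inner_smul_left, real_inner_smul_right, norm_smul, inv_mul_cancel_left₀ hl.ne',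
    Real.norm_of_nonneg hl.le]
  congr 2
  push_cast
  field_simp

/-- After Plancherel the integrand is a single complex Gaussian in `ξ`: the two widths contribute
`π(1 + l²)` to its quadratic coefficient and the propagator contributes the imaginary part. -/
theorem inner_rescale_propagator_gaussianL2 (τ : ℝ) {l : ℝ} (hl : 0 < l) (w z : Plane) :
    inner ℂ (rescale l (propagator τ (gaussianL2 Real.pi_pos w))) (gaussianL2 Real.pi_pos z) =
      (l : ℂ) * Complex.exp (-(Real.pi * (‖w‖ ^ 2 + ‖z‖ ^ 2) : ℝ)) *
        ((Real.pi / ((Real.pi * (1 + l ^ 2) : ℝ) - (4 * Real.pi ^ 2 * τ : ℝ) * Complex.I)) *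
          Complex.exp ((Real.pi ^ 2 * ‖w + l • z‖ ^ 2 : ℝ) /
            ((Real.pi * (1 + l ^ 2) : ℝ) - (4 * Real.pi ^ 2 * τ : ℝ) * Complex.I))) := by
  set B : ℂ := (Real.pi * (1 + l ^ 2) : ℝ) - (4 * Real.pi ^ 2 * τ : ℝ) * Complex.I with hB
  have hBre : 0 < B.re := by
    have := Real.pi_pos
    simp only [hB, Complex.sub_re, Complex.ofReal_re, Complex.re_ofReal_mul, Complex.I_re,
      mul_zero, sub_zero]
    positivity
  have hI := GaussianFourier.integral_cexp_neg_mul_sq_norm_add hBre (2 * Real.pi) (w + l • z)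
  rw [finrank_euclideanSpace, Fintype.card_fin, Nat.cast_ofNat, div_self two_ne_zero,
    Complex.cpow_one] at hI
  have hexp : ((2 * Real.pi : ℂ)) ^ 2 * (‖w + l • z‖ : ℂ) ^ 2 / (4 * B) =
      (Real.pi ^ 2 * ‖w + l • z‖ ^ 2 : ℝ) / B := by
    have hB0 : B ≠ 0 := fun h => by simp [h] at hBre
    push_cast
    field_simp
    ring
  rw [hexp] at hI
  rw [← hI, ← rescale_gaussianL2 hl z, inner_rescale_rescale hl.ne', inner_smul_right,
    ← Lp.inner_fourier_eq, L2.inner_def, ← integral_const_mul, ← integral_const_mul]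
  refine integral_congr_ae ?_
  have hl' : (l : ℂ) ≠ 0 := by exact_mod_cast hl.ne'
  have hpi : (Real.pi : ℂ) ≠ 0 := by exact_mod_cast Real.pi_ne_zero
  filter_upwards [coeFn_fourier_propagator τ (gaussianL2 Real.pi_pos w),
    coeFn_fourier_gaussianL2 Real.pi_pos w,
    coeFn_fourier_gaussianL2 (div_pos Real.pi_pos (pow_pos hl 2)) (l⁻¹ • z)] with ξ h₁ h₂ h₃
  rw [h₁, h₂, h₃, RCLike.inner_apply]
  have e₁ : (‖w - ξ‖ : ℂ) ^ 2 = ‖w‖ ^ 2 - 2 * (inner ℝ w ξ : ℝ) + ‖ξ‖ ^ 2 := by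
    exact_mod_cast norm_sub_sq_real w ξ
  have e₂ : (‖l⁻¹ • z - ξ‖ : ℂ) ^ 2 =
      (l : ℂ)⁻¹ ^ 2 * ‖z‖ ^ 2 - 2 * ((l : ℂ)⁻¹ * (inner ℝ z ξ : ℝ)) + ‖ξ‖ ^ 2 := by
    have := norm_sub_sq_real (l⁻¹ • z) ξ
    rw [norm_smul, real_inner_smul_left, Real.norm_of_nonneg (by positivity), mul_pow] at this
    exact_mod_cast this
  have e₃ : ((inner ℝ (w + l • z) ξ : ℝ) : ℂ) = (inner ℝ w ξ : ℝ) + l * (inner ℝ z ξ : ℝ) := by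
    rw [inner_add_left, real_inner_smul_left]
    push_cast
    rfl
  rw [e₁, e₂, e₃, div_self hpi, one_mul, map_mul, symbol, ← Complex.exp_conj, ← Complex.exp_conj]
  simp only [map_mul, map_neg, map_div₀, map_add, map_sub, map_pow, Complex.conj_ofReal,
    Complex.conj_I, map_ofNat]
  have : (l : ℂ)⁻¹ * ((Real.pi / (Real.pi / l ^ 2 : ℝ) : ℂ)) = l := by
    push_cast
    field_simp
  have hab (a b c d e : ℂ) : a * (b * c * (d * e)) = (a * b) * (c * (d * e)) := by ring
  rw [hab, this, mul_assoc (l : ℂ), ← Complex.exp_add, ← Complex.exp_add, ← Complex.exp_add, hB]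
  congr 2
  push_cast
  field_simp
  ring

/-- The point is that the bound does not depend on `l`: the prefactor `l` is absorbed by the real
part of the denominator, the decay comes from its imaginary part. -/
theorem norm_inner_rescale_propagator_gaussianL2_le {τ : ℝ} (hτ : τ ≠ 0) {l : ℝ} (hl : 0 < l)
    (w z : Plane) :
    ‖inner ℂ (rescale l (propagator τ (gaussianL2 Real.pi_pos w))) (gaussianL2 Real.pi_pos z)‖ ≤
      1 / √|τ| := by
  rw [inner_rescale_propagator_gaussianL2 τ hl]
  set B : ℂ := (Real.pi * (1 + l ^ 2) : ℝ) - (4 * Real.pi ^ 2 * τ : ℝ) * Complex.I with hB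
  have hpi := Real.pi_pos
  have hτ' : 0 < √|τ| := Real.sqrt_pos.2 (abs_pos.2 hτ)
  have hre : B.re = Real.pi * (1 + l ^ 2) := by
    simp only [hB, Complex.sub_re, Complex.ofReal_re, Complex.re_ofReal_mul, Complex.I_re,
      mul_zero, sub_zero]
  have him : B.im = -(4 * Real.pi ^ 2 * τ) := by
    simp only [hB, Complex.sub_im, Complex.ofReal_im, Complex.im_ofReal_mul, Complex.I_im,
      mul_one, zero_sub]
  have hB₁ : Real.pi * (1 + l ^ 2) ≤ ‖B‖ := hre ▸ Complex.re_le_norm B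
  have hB₂ : 4 * Real.pi ^ 2 * |τ| ≤ ‖B‖ := by
    have := Complex.abs_im_le_norm B
    rwa [him, abs_neg, abs_mul, abs_of_nonneg (by positivity : 0 ≤ 4 * Real.pi ^ 2)] at this
  have hB₀ : 0 < ‖B‖ := lt_of_lt_of_le (by positivity) hB₁
  -- Geometric mean of the two lower bounds for `‖B‖`.
  have hB₃ : l * Real.pi * √|τ| ≤ ‖B‖ := by
    refine le_of_sq_le_sq ?_ hB₀.le
    rw [mul_pow, mul_pow, Real.sq_sqrt (abs_nonneg τ)]
    calc l ^ 2 * Real.pi ^ 2 * |τ| ≤ (Real.pi * (1 + l ^ 2)) * (4 * Real.pi ^ 2 * |τ|) := by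
          have h1 : 1 ≤ 4 * Real.pi := by linarith [Real.pi_gt_three]
          have h2 : 0 ≤ Real.pi ^ 2 * |τ| := by positivity
          nlinarith [mul_nonneg h2 (sq_nonneg l), mul_nonneg h2 (mul_nonneg (sq_nonneg l)
            (sub_nonneg.2 h1)), mul_nonneg h2 hpi.le]
      _ ≤ ‖B‖ ^ 2 := by
          rw [pow_two ‖B‖]
          gcongr
  have hexp : ‖Complex.exp (-(Real.pi * (‖w‖ ^ 2 + ‖z‖ ^ 2) : ℝ))‖ *
      ‖Complex.exp ((Real.pi ^ 2 * ‖w + l • z‖ ^ 2 : ℝ) / B)‖ ≤ 1 := by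
    rw [Complex.norm_exp, Complex.norm_exp, ← Real.exp_add, Real.exp_le_one_iff,
      ← Complex.ofReal_neg, Complex.ofReal_re]
    have h1 : ((Real.pi ^ 2 * ‖w + l • z‖ ^ 2 : ℝ) / B : ℂ).re ≤
        Real.pi ^ 2 * ‖w + l • z‖ ^ 2 / (Real.pi * (1 + l ^ 2)) := by
      refine (Complex.re_le_norm _).trans ?_
      rw [norm_div, Complex.norm_real, Real.norm_of_nonneg (by positivity)]
      gcongr
    -- Cauchy–Schwarz for `(1, l)` and `(‖w‖, ‖z‖)`; it makes the growing exponential at most the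
    -- inverse of the decaying one.
    have h2 : ‖w + l • z‖ ^ 2 ≤ (‖w‖ ^ 2 + ‖z‖ ^ 2) * (1 + l ^ 2) := by
      have h3 : ‖w + l • z‖ ≤ ‖w‖ + l * ‖z‖ := by
        refine (norm_add_le _ _).trans_eq ?_
        rw [norm_smul, Real.norm_of_nonneg hl.le]
      have h4 : ‖w + l • z‖ ^ 2 ≤ (‖w‖ + l * ‖z‖) ^ 2 := by gcongr
      nlinarith [sq_nonneg (l * ‖w‖ - ‖z‖)]
    have h5 : Real.pi ^ 2 * ‖w + l • z‖ ^ 2 / (Real.pi * (1 + l ^ 2)) ≤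
        Real.pi * (‖w‖ ^ 2 + ‖z‖ ^ 2) := by
      rw [div_le_iff₀ (by positivity)]
      nlinarith [mul_le_mul_of_nonneg_left h2 (sq_nonneg Real.pi)]
    linarith
  rw [norm_mul, norm_mul, norm_mul, norm_div, Complex.norm_real, Complex.norm_real,
    Real.norm_of_nonneg hl.le, Real.norm_of_nonneg hpi.le]
  calc _ = (l * Real.pi / ‖B‖) * (‖Complex.exp (-(Real.pi * (‖w‖ ^ 2 + ‖z‖ ^ 2) : ℝ))‖ *
      ‖Complex.exp ((Real.pi ^ 2 * ‖w + l • z‖ ^ 2 : ℝ) / B)‖) := by ring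
    _ ≤ l * Real.pi / ‖B‖ := mul_le_of_le_one_right (by positivity) hexp
    _ ≤ 1 / √|τ| := by
      rw [div_le_div_iff₀ hB₀ hτ', one_mul]
      exact hB₃

/-! ### Weak convergence to zero -/

section Weak

variable {ι H : Type*} [NormedAddCommGroup H] [InnerProductSpace ℂ H] {L : Filter ι}

/-- Equibounded functionals that tend to zero on a set with dense span tend to zero everywhere. -/
theorem tendsto_zero_of_span_dense {Φ : ι → H →ₗ[ℂ] ℂ} {C : ℝ}
    (hΦ : ∀ᶠ i in L, ∀ x, ‖Φ i x‖ ≤ C * ‖x‖) {S : Set H}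
    (hS : (Submodule.span ℂ S).topologicalClosure = ⊤)
    (h : ∀ x ∈ S, Tendsto (fun i => Φ i x) L (𝓝 0)) (x : H) :
    Tendsto (fun i => Φ i x) L (𝓝 0) := by
  have hspan : ∀ y ∈ Submodule.span ℂ S, Tendsto (fun i => Φ i y) L (𝓝 0) := by
    intro y hy
    induction hy using Submodule.span_induction with
    | mem y hy => exact h y hy
    | zero => simp [tendsto_const_nhds]
    | add y z _ _ hy hz => simpa using hy.add hz
    | smul c y _ hy => simpa using hy.const_mul c
  rw [Metric.tendsto_nhds]
  intro ε hε
  have hx : x ∈ closure (Submodule.span ℂ S : Set H) := by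
    rw [← Submodule.topologicalClosure_coe, hS]
    trivial
  -- `|C| + 1` keeps the divisor positive with no sign condition on `C`.
  obtain ⟨y, hy, hxy⟩ := Metric.mem_closure_iff.1 hx (ε / (2 * (|C| + 1))) (by positivity)
  filter_upwards [hΦ, Metric.tendsto_nhds.1 (hspan y hy) (ε / 2) (half_pos hε)] with i h₁ h₂
  rw [dist_zero_right] at h₂ ⊢
  have h₃ : ‖Φ i (x - y)‖ ≤ ε / 2 := by
    refine (h₁ _).trans ?_
    rw [dist_eq_norm, lt_div_iff₀ (by positivity)] at hxy
    nlinarith [le_abs_self C, norm_nonneg (x - y)]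
  calc ‖Φ i x‖ = ‖Φ i (x - y) + Φ i y‖ := by rw [← map_add, sub_add_cancel]
    _ ≤ ‖Φ i (x - y)‖ + ‖Φ i y‖ := norm_add_le _ _
    _ < ε := by linarith

/-- Equibounded operators whose matrix coefficients tend to zero on a set with dense span tend to
zero weakly. -/
theorem tendsto_inner_zero_of_span_dense {A : ι → H →ₗ[ℂ] H}
    (hA : ∀ᶠ i in L, ∀ x, ‖A i x‖ ≤ ‖x‖) {S : Set H}
    (hS : (Submodule.span ℂ S).topologicalClosure = ⊤)
    (h : ∀ x ∈ S, ∀ y ∈ S, Tendsto (fun i => inner ℂ (A i x) y) L (𝓝 0)) (x y : H) :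
    Tendsto (fun i => inner ℂ (A i x) y) L (𝓝 0) := by
  have h₁ : ∀ x ∈ S, ∀ y, Tendsto (fun i => inner ℂ (A i x) y) L (𝓝 0) := by
    intro x hx y
    refine tendsto_zero_of_span_dense (Φ := fun i => (innerₛₗ ℂ (A i x))) (C := ‖x‖) ?_ hS
      (h x hx) y
    filter_upwards [hA] with i hi y
    refine (norm_inner_le_norm _ _).trans ?_
    gcongr
    exact hi x
  -- The inner product is conjugate-linear in its first slot, so the second density argument is run
  -- on the conjugate.
  have h₂ : Tendsto (fun i => inner ℂ y (A i x)) L (𝓝 0) := by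
    refine tendsto_zero_of_span_dense (Φ := fun i => (innerₛₗ ℂ y) ∘ₗ A i) (C := ‖y‖) ?_ hS
      (fun x hx => ?_) x
    · filter_upwards [hA] with i hi x
      refine (norm_inner_le_norm _ _).trans ?_
      gcongr
      exact hi x
    · have := (h₁ x hx y).star
      simpa [← starRingEnd_apply, inner_conj_symm] using this
  have := h₂.star
  simpa [← starRingEnd_apply, inner_conj_symm] using this

/-- A bounded weakly null family tends to zero when tested against vectors of a compact set. -/
theorem tendsto_inner_zero_of_isCompact {a v : ι → H} {C : ℝ} (ha : ∀ᶠ i in L, ‖a i‖ ≤ C)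
    (hweak : ∀ y, Tendsto (fun i => inner ℂ (a i) y) L (𝓝 0)) {K : Set H} (hK : IsCompact K)
    (hv : ∀ᶠ i in L, v i ∈ K) : Tendsto (fun i => inner ℂ (a i) (v i)) L (𝓝 0) := by
  rw [Metric.tendsto_nhds]
  intro ε hε
  obtain ⟨s, hs, hsK⟩ := Metric.totallyBounded_iff.1 hK.totallyBounded (ε / (2 * (|C| + 1)))
    (by positivity)
  have hfin : ∀ᶠ i in L, ∀ y ∈ s, dist (inner ℂ (a i) y) 0 < ε / 2 :=
    (eventually_all_finite hs).2 fun y _ => Metric.tendsto_nhds.1 (hweak y) _ (half_pos hε)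
  filter_upwards [ha, hv, hfin] with i h₁ h₂ h₃
  obtain ⟨y, hy, hvy⟩ := Set.mem_iUnion₂.1 (hsK h₂)
  have h₄ := h₃ y hy
  rw [dist_zero_right] at h₄ ⊢
  have h₅ : ‖inner ℂ (a i) (v i - y)‖ ≤ ε / 2 := by
    refine (norm_inner_le_norm _ _).trans ?_
    rw [Metric.mem_ball, dist_eq_norm, lt_div_iff₀ (by positivity)] at hvy
    nlinarith [le_abs_self C, norm_nonneg (v i - y), norm_nonneg (a i)]
  calc ‖inner ℂ (a i) (v i)‖ = ‖inner ℂ (a i) (v i - y) + inner ℂ (a i) y‖ := by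
        rw [← inner_add_right, sub_add_cancel]
    _ ≤ ‖inner ℂ (a i) (v i - y)‖ + ‖inner ℂ (a i) y‖ := norm_add_le _ _
    _ < ε := by linarith

end Weak

/-- Free evolutions, observed at an arbitrary time-dependent scale, tend to zero weakly. -/
theorem tendsto_inner_rescale_propagator {τ lam : ℝ → ℝ} (hτ : Tendsto τ atTop atTop)
    (hlam : ∀ T, 0 < lam T) (f g : L2) :
    Tendsto (fun T => inner ℂ (rescale (lam T) (propagator (τ T) f)) g) atTop (𝓝 0) := by
  refine tendsto_inner_zero_of_span_dense
    (A := fun T => ((rescaleₗᵢ (lam T) (hlam T).ne').comp (propagatorₗᵢ (τ T))).toLinearMap)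
    (Eventually.of_forall fun T x => (LinearIsometry.norm_map _ x).le)
    span_gaussianL2_topologicalClosure ?_ f g
  rintro _ ⟨w, rfl⟩ _ ⟨z, rfl⟩
  have hlim : Tendsto (fun T => 1 / √|τ T|) atTop (𝓝 0) :=
    tendsto_const_nhds.div_atTop
      (Real.tendsto_sqrt_atTop.comp (tendsto_abs_atTop_atTop.comp hτ))
  refine squeeze_zero_norm' ?_ hlim
  filter_upwards [hτ.eventually_gt_atTop 0] with T hT
  exact norm_inner_rescale_propagator_gaussianL2_le hT.ne' (hlam T) w z

/-! ### The Duhamel formula -/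

theorem inner_propagator_left (t : ℝ) (f g : L2) :
    inner ℂ (propagator t f) g = inner ℂ f (propagator (-t) g) := by
  rw [← (propagatorₗᵢ (-t)).inner_map_map (propagator t f) g, propagatorₗᵢ_apply,
    propagatorₗᵢ_apply, ← propagator_add, neg_add_cancel, propagator_zero]

theorem intervalIntegrable_propagator {N : ℝ → L2} {a b : ℝ}
    (hN : IntervalIntegrable N volume a b) (t : ℝ) :
    IntervalIntegrable (fun s => propagator (t - s) (N s)) volume a b := by
  rw [intervalIntegrable_iff] at hN ⊢
  exact Integrable.mono hN
    (Continuous.comp_aestronglyMeasurable₂ (g := propagator) continuous_propagator (by fun_prop)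
      hN.aestronglyMeasurable)
    (ae_of_all _ fun s => (norm_propagator (t - s) (N s)).le)

theorem propagator_integral {N : ℝ → L2} {a b : ℝ}
    (hN : IntervalIntegrable N volume a b) (r t : ℝ) :
    propagator r (∫ s in a..b, propagator (t - s) (N s)) =
      ∫ s in a..b, propagator (r + t - s) (N s) := by
  have h := (propagatorₗᵢ r).toContinuousLinearMap.intervalIntegral_comp_comm
    (intervalIntegrable_propagator hN t)
  simp only [LinearIsometry.coe_toContinuousLinearMap, propagatorₗᵢ_apply] at h
  rw [← h]
  simp only [← propagator_add, add_sub_assoc]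

/-- Apply `propagator (t - T)` to the Duhamel formula at time `T` and subtract the result from the
formula at time `t`; the group law aligns the integrands. -/
theorem IsForwardGlobalSolution.smul_integral_eq {u : ℝ → L2} (hu : IsForwardGlobalSolution u)
    {t T : ℝ} (ht : 0 ≤ t) (hT : 0 ≤ T) :
    Complex.I • ∫ s in t..T, propagator (t - s) (nonlinearity (u s)) =
      u t - propagator (t - T) (u T) := by
  have hNt := hu.integrable_nonlinearity t ht
  have hNT := hu.integrable_nonlinearity T hT
  have h : propagator (t - T) (u T) = propagator t (u 0) -
      Complex.I • ∫ s in (0 : ℝ)..T, propagator (t - s) (nonlinearity (u s)) := by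
    conv_lhs => rw [hu.duhamel T hT]
    rw [← propagatorₗᵢ_apply, map_sub, map_smul, propagatorₗᵢ_apply, propagatorₗᵢ_apply,
      propagator_integral hNT, ← propagator_add, sub_add_cancel]
  rw [h]
  conv_rhs => rw [hu.duhamel t ht]
  rw [← intervalIntegral.integral_interval_sub_left (intervalIntegrable_propagator hNT t)
    (intervalIntegrable_propagator hNt t), smul_sub]
  abel

end CubicQuinticNLS

open CubicQuinticNLS in
theorem corollary3p4 (u : ℝ → L2) (lam : ℝ → ℝ) (hu : IsCompactSolution u lam)
    (t : ℝ) (ht : 0 ≤ t) :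
    (∀ T : ℝ, t ≤ T →
      IntervalIntegrable (fun s => propagator (t - s) (nonlinearity (u s))) volume t T) ∧
    ∀ g : L2,
      Tendsto
        (fun T : ℝ =>
          inner ℂ g (Complex.I • ∫ s in t..T, propagator (t - s) (nonlinearity (u s))))
        atTop (𝓝 (inner ℂ g (u t))) := by
  refine ⟨fun T hT => intervalIntegrable_propagator
    ((hu.solution.integrable_nonlinearity t ht).symm.trans
      (hu.solution.integrable_nonlinearity T (ht.trans hT))) t, fun g => ?_⟩
  -- `lam` is controlled only at nonnegative times; the maximum is positive everywhere and agrees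
  -- with it there.
  set l : ℝ → ℝ := fun T => max 1 (lam T) with hl
  have hl₀ : ∀ T, 0 < l T := fun T => lt_of_lt_of_le one_pos (le_max_left _ _)
  have hl₁ : ∀ T, 0 ≤ T → l T = lam T := fun T hT => max_eq_right (hu.one_le_scale T hT)
  have hτ : Tendsto (fun T : ℝ => T - t) atTop atTop := tendsto_atTop_add_const_right _ _ tendsto_id
  have hzero : Tendsto (fun T => inner ℂ (rescale (l T) (propagator (T - t) g))
      (rescale (l T) (u T))) atTop (𝓝 0) := by
    refine tendsto_inner_zero_of_isCompact (C := ‖g‖) (Eventually.of_forall fun T => ?_)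
      (tendsto_inner_rescale_propagator hτ hl₀ g) hu.precompact ?_
    · exact (((rescaleₗᵢ (l T) (hl₀ T).ne').comp (propagatorₗᵢ (T - t))).norm_map g).le
    · filter_upwards [eventually_ge_atTop 0] with T hT
      rw [hl₁ T hT]
      exact subset_closure ⟨T, hT, rfl⟩
  have hlim : Tendsto (fun T => inner ℂ g (u t) - inner ℂ (rescale (l T) (propagator (T - t) g))
      (rescale (l T) (u T))) atTop (𝓝 (inner ℂ g (u t))) := by
    simpa using hzero.const_sub (inner ℂ g (u t))
  refine hlim.congr' ?_
  filter_upwards [eventually_ge_atTop 0] with T hT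
  rw [inner_rescale_rescale (hl₀ T).ne', inner_propagator_left, neg_sub,
    hu.solution.smul_integral_eq ht hT, inner_sub_right]
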